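/- Let $V$ be a finite set of spins, each with local Hilbert space $\mathbb{C}^d$, and let $\mathcal H=\bigotimes_{v\in V}\mathbb{C}^d$. Let $S$ be a set of subsets of $V$ and let $$H=\sum_{X\in S}\lambda_X h_X$$ be a $k$-local Hamiltonian on $\mathcal H$, i.e. $|X|\le k$ for all $X\in S$, where $\lambda_X\in\mathbb{R}$, $|\lambda_X|\le 1$, and each $h_X$ is Hermitian with operator norm $\|h_X\|=1$ and support exactly $X$ (that is, $X$ is the smallest subset of $V$ on which $h_X$ acts nontrivially). Let $\mathfrak d$ be the maximum degree of the interaction graph, i.e. of the simple graph with vertex set $S$ in which $X\neq Y$ are adjacent if and only if $X\cap Y\neq\emptyset$. Assume $\mathfrak d\ge 1$ and put $$t_L^*=\frac{1}{2e^2\,\mathfrak d(\mathfrak d+1)}.$$ Let $|\Phi\rangle=\bigotimes_{v\in V}|\phi_v\rangle$ be a product state with $\|\phi_v\|=1$ for all $v\in V$. Let $t_{\mathrm{QSL}}=\min\{t\ge 0:\langle\Phi|e^{-itH}|\Phi\rangle=0\}$, with $t_{\mathrm{QSL}}=\infty$ if there is no such $t$. Then $$t_{\mathrm{QSL}}\ge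 t_L^*.$$ Moreover, for every real $t$ with $|t|<t_L^*$, $$\bigl|\langle\Phi|e^{-itH}|\Phi\rangle\bigr|\ \ge\ \exp\left[-|S|\,\frac{(|t|/t_L^*)^4}{1-(|t|/t_L^*)^2}\right]e^{-(\Delta H)^2t^2/2},$$ where $(\Delta H)^2=\langle\Phi|(H-\langle H\rangle)^2|\Phi\rangle$ and $\langle H\rangle=\langle\Phi|H|\Phi\rangle$. -/

import Mathlib

open scoped Matrix

noncomputable section

namespace SpinSystem

/-- State vectors of the spins `V` with local dimension `d`, i.e. elements of `⨂_{v ∈ V} ℂ^d`,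
written in the orthonormal product basis `|s⟩`, which is indexed by the configurations
`s : V → Fin d`. -/
abbrev StateVector (V : Type*) (d : ℕ) : Type _ :=
  (V → Fin d) → ℂ

/-- Linear operators on `⨂_{v ∈ V} ℂ^d`, given by the matrix elements `A s s' = ⟨s| A |s'⟩` in the
product basis. -/
abbrev Operator (V : Type*) (d : ℕ) : Type _ :=
  Matrix (V → Fin d) (V → Fin d) ℂ

variable {V : Type*} [Fintype V] [DecidableEq V] {d : ℕ}

/-- The operator norm of `A` with respect to the Hilbert space (`ℓ²`) norm. -/
def opNorm (A : Operator V d) : ℝ :=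
  ‖Matrix.toEuclideanCLM (n := V → Fin d) (𝕜 := ℂ) A‖

/-- `A` acts on the subsystem `X`, that is `A = a ⊗ 1` for some operator `a` on the tensor factor
`⨂_{v ∈ X} ℂ^d`, with the identity on the spins outside `X`. -/
def ActsOn (A : Operator V d) (X : Finset V) : Prop :=
  ∃ a : Operator X d, ∀ s s' : V → Fin d,
    A s s' = if ∀ v, v ∉ X → s v = s' v then a (fun v => s v) (fun v => s' v) else 0

/-- `supp A = X`: the smallest subsystem on which `A` acts is `X`. -/
def HasSupport (A : Operator V d) (X : Finset V) : Prop :=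
  IsLeast {Y : Finset V | ActsOn A Y} X

/-- The data of a Hamiltonian `H = ∑_{X ∈ S} λ_X h_X`: a set `S` of subsystems, real
coefficients with `|λ_X| ≤ 1`, and Hermitian operators `h_X` with `supp h_X = X`, `‖h_X‖ = 1`.
The values of `coeff` and `term` outside `S` are irrelevant. -/
structure Hamiltonian (V : Type*) [Fintype V] [DecidableEq V] (d : ℕ) where
  S : Finset (Finset V)
  coeff : Finset V → ℝ
  term : Finset V → Operator V d
  abs_coeff_le_one : ∀ X ∈ S, |coeff X| ≤ 1
  term_isHermitian : ∀ X ∈ S, (term X).IsHermitian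
  term_support : ∀ X ∈ S, HasSupport (term X) X
  norm_term : ∀ X ∈ S, opNorm (term X) = 1

namespace Hamiltonian

/-- The operator `H = ∑_{X ∈ S} λ_X h_X`. -/
def toOperator (H : Hamiltonian V d) : Operator V d :=
  ∑ X ∈ H.S, (H.coeff X : ℂ) • H.term X

/-- `H` is `k`-local: every term acts on at most `k` spins. -/
def IsLocal (H : Hamiltonian V d) (k : ℕ) : Prop :=
  ∀ X ∈ H.S, X.card ≤ k

/-- The interaction graph: its vertices are the subsystems in `S`, two different ones being
adjacent if they overlap. -/
def interactionGraph (H : Hamiltonian V d) : SimpleGraph H.S where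
  Adj X Y := X ≠ Y ∧ ((X : Finset V) ∩ (Y : Finset V)).Nonempty
  symm := ⟨fun X Y h => ⟨h.1.symm, by rw [Finset.inter_comm]; exact h.2⟩⟩
  loopless := ⟨fun _ h => h.1 rfl⟩

open Classical in
/-- The maximum degree `𝔡` of the interaction graph. -/
def maxDegree (H : Hamiltonian V d) : ℕ :=
  H.interactionGraph.maxDegree

/-- The threshold time `t_L^* = 1 / (2 e² 𝔡 (𝔡 + 1))`. -/
def thresholdTime (H : Hamiltonian V d) : ℝ :=
  1 / (2 * Real.exp 1 ^ 2 * (H.maxDegree : ℝ) * ((H.maxDegree : ℝ) + 1))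

end Hamiltonian

/-- `Φ` is a product state: the tensor product `⨂_{v ∈ V} φ_v` of one unit vector per spin. -/
def IsProductState (Φ : StateVector V d) : Prop :=
  ∃ φ : V → Fin d → ℂ, (∀ v, ∑ i, ‖φ v i‖ ^ 2 = 1) ∧ ∀ s, Φ s = ∏ v, φ v (s v)

/-- The expectation value `⟨Φ| A |Φ⟩`. -/
def expectation (A : Operator V d) (Φ : StateVector V d) : ℂ :=
  star Φ ⬝ᵥ (A *ᵥ Φ)

/-- The amplitude `⟨Φ| e^{-itA} |Φ⟩`. -/
def amplitude (A : Operator V d) (Φ : StateVector V d) (t : ℝ) : ℂ :=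
  expectation (NormedSpace.exp ((-(Complex.I * (t : ℂ))) • A)) Φ

/-- The variance `(ΔA)² = ⟨Φ| (A - ⟨A⟩)² |Φ⟩`, a real number when `A` is Hermitian. -/
def variance (A : Operator V d) (Φ : StateVector V d) : ℝ :=
  (expectation ((A - expectation A Φ • (1 : Operator V d)) ^ 2) Φ).re

/-- The quantum speed limit time: the first time `t ≥ 0` at which `⟨Φ| e^{-itA} |Φ⟩ = 0`, and `⊤`
if there is no such time. -/
def tQSL (A : Operator V d) (Φ : StateVector V d) : EReal :=
  sInf ((fun t : ℝ => (t : EReal)) '' {t : ℝ | 0 ≤ t ∧ amplitude A Φ t = 0})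

end SpinSystem

end

/-!
For a set `T` of terms of `H`, let `Z_T(z) = ⟨Φ| exp(z ∑_{X ∈ T} λ_X h_X) |Φ⟩` with complex `z`.
The amplitude is `Z_S(-it)`, and the theorem follows once `Z_S` is shown to have an analytic
logarithm `g` bounded by `|S|` on the disc of radius `t_L^*`. By Cauchy's estimate the `n`-th Taylor
coefficient of `g` is then at most `|S| / (t_L^*)^n`. Since `H` is Hermitian, the modulus of the
amplitude is even in `t`, so only the even coefficients contribute to `log |Z_S(-it)|`: the quadratic
one gives the variance, and the others form a geometric series starting at order four
(`norm_even_part_sub_le`).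

The logarithm comes from a polymer expansion on the interaction graph. Because `Φ` is a product
state, `Z` is multiplicative over sets of terms that do not overlap
(`SpinSystem.Hamiltonian.partitionFunction_union`), hence so is its Möbius transform
`W(Γ) = ∑_{U ⊆ Γ} (-1)^{|Γ \ U|} Z_U`. In the expansion of the exponentials, `W(Γ)` retains the words
in which every term of `Γ` occurs, so `|W(Γ)| ≤ (e^{|z|} - 1)^{|Γ|}` (`norm_altSum_exp_le`).
Splitting off the connected component `γ` of a term `X` gives
`Z_T - Z_{T \ X} = ∑_γ W(γ) Z_{T \ N[γ]}`, where `N[γ]` is the closed neighbourhood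
(`SimpleGraph.sub_erase_eq_sum_rooted`). With a bound on the generating function of connected
sets containing a given vertex (`SimpleGraph.sum_rooted_le`), induction on `|T|` shows that for
`|z| ≤ t_L^*` the ratio `Z_T / Z_{T \ X}` differs from `1` by at most `1 / (𝔡 + 2) ≤ 1 / 2`
(`SimpleGraph.ne_zero_and_norm_sub_erase_le`). The sum of the principal logarithms of such ratios
is `g`.
-/

/-! ### Alternating sums over subsets -/

/-- The Möbius transform `∑_{U ⊆ s} (-1)^{|s \ U|} F U` of a set function `F`. -/
def altSum {ι E : Type*} [DecidableEq ι] [AddCommGroup E] (F : Finset ι → E) (s : Finset ι) : E :=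
  ∑ U ∈ s.powerset, (-1 : ℤ) ^ (s \ U).card • F U

section AltSum

variable {ι E : Type*} [DecidableEq ι] [AddCommGroup E]

@[simp] theorem altSum_empty (F : Finset ι → E) : altSum F ∅ = F ∅ := by
  simp [altSum]

theorem altSum_insert (F : Finset ι → E) {a : ι} {s : Finset ι} (ha : a ∉ s) :
    altSum F (insert a s) = altSum (fun U => F (insert a U)) s - altSum F s := by
  unfold altSum
  rw [Finset.sum_powerset_insert ha, add_comm, sub_eq_add_neg, ← Finset.sum_neg_distrib]
  congr 1
  · refine Finset.sum_congr rfl fun U hU => ?_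
    have : insert a s \ insert a U = s \ U := by
      ext v
      simp only [Finset.mem_sdiff, Finset.mem_insert]
      constructor
      · tauto
      · rintro ⟨h1, h2⟩
        refine ⟨Or.inr h1, ?_⟩
        rintro (rfl | h)
        exacts [ha h1, h2 h]
    rw [this]
  · refine Finset.sum_congr rfl fun U hU => ?_
    have haU : a ∉ U := fun h => ha (Finset.mem_powerset.1 hU h)
    rw [Finset.insert_sdiff_of_notMem _ haU, Finset.card_insert_of_notMem (by simp [ha]), pow_succ,
      mul_neg_one, neg_smul]

/-- Möbius inversion. -/
theorem sum_powerset_altSum (F : Finset ι → E) (s : Finset ι) :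
    ∑ U ∈ s.powerset, altSum F U = F s := by
  induction s using Finset.induction_on generalizing F with
  | empty => simp
  | insert a s ha ih =>
    rw [Finset.sum_powerset_insert ha, ← Finset.sum_add_distrib, ← ih fun U => F (insert a U)]
    refine Finset.sum_congr rfl fun U hU => ?_
    rw [altSum_insert F fun h => ha (Finset.mem_powerset.1 hU h)]
    abel

theorem altSum_congr {F F' : Finset ι → E} {s : Finset ι} (h : ∀ U ⊆ s, F U = F' U) :
    altSum F s = altSum F' s :=
  Finset.sum_congr rfl fun U hU => by rw [h U (Finset.mem_powerset.1 hU)]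

theorem altSum_zero (s : Finset ι) : altSum (fun _ => (0 : E)) s = 0 := by
  simp [altSum]

theorem altSum_mul_left {R : Type*} [Ring R] (c : R) (F : Finset ι → R) (s : Finset ι) :
    altSum (fun U => c * F U) s = c * altSum F s := by
  simp only [altSum, Finset.mul_sum, mul_smul_comm]

theorem altSum_union {R : Type*} [CommRing R] (F : Finset ι → R) {s t : Finset ι}
    (hst : Disjoint s t) (h : ∀ U ⊆ s, ∀ U' ⊆ t, F (U ∪ U') = F U * F U') :
    altSum F (s ∪ t) = altSum F s * altSum F t := by
  -- generalised so that the induction can move one point at a time from `s` into the set function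
  suffices ∀ G F' : Finset ι → R, (∀ U ⊆ s, ∀ U' ⊆ t, G (U ∪ U') = F' U * F U') →
      altSum G (s ∪ t) = altSum F' s * altSum F t from this F F h
  clear h
  induction s using Finset.induction_on with
  | empty =>
    intro G F' h
    rw [Finset.empty_union, altSum_empty, ← altSum_mul_left]
    exact altSum_congr fun U hU => by simpa using h ∅ subset_rfl U hU
  | insert a s ha ih =>
    intro G F' h
    rw [Finset.disjoint_insert_left] at hst
    rw [Finset.insert_union, altSum_insert _ (by simp [ha, hst.1]), altSum_insert _ ha, sub_mul,
      ih hst.2 G F' fun U hU U' hU' => h U (hU.trans (Finset.subset_insert _ _)) U' hU',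
      ih hst.2 (fun U => G (insert a U)) (fun U => F' (insert a U)) fun U hU U' hU' => by
        rw [← Finset.insert_union]
        exact h _ (Finset.insert_subset_insert a hU) U' hU']

end AltSum

/-! ### Alternating sums of exponentials in a Banach algebra -/

section AltSumExp

variable {ι : Type*} [DecidableEq ι]

theorem altSum_sum_mul {R : Type*} [Ring R] (a : ι → R) (F : Finset ι → R) (s : Finset ι) :
    altSum (fun U => (∑ i ∈ U, a i) * F U) s
      = ∑ i ∈ s, a i * (altSum F s + altSum F (s.erase i)) := by
  have key : ∀ i ∈ s, altSum F s + altSum F (s.erase i)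
      = altSum (fun U => if i ∈ U then F U else 0) s := by
    intro i hi
    obtain ⟨t, hit, rfl⟩ : ∃ t, i ∉ t ∧ insert i t = s :=
      ⟨s.erase i, Finset.notMem_erase i s, Finset.insert_erase hi⟩
    rw [Finset.erase_insert hit, altSum_insert _ hit, altSum_insert _ hit,
      altSum_congr (F := fun U => if i ∈ U then F U else 0) (F' := fun _ => 0) (s := t), altSum_zero]
    · simp
    · exact fun U hU => if_neg fun h => hit (hU h)
  rw [Finset.sum_congr rfl fun i hi => by rw [key i hi, ← altSum_mul_left]]
  unfold altSum
  rw [Finset.sum_comm]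
  refine Finset.sum_congr rfl fun U hU => ?_
  rw [← Finset.smul_sum]
  congr 1
  simp only [Finset.sum_mul]
  simp only [mul_ite, mul_zero, ← Finset.sum_filter]
  rw [Finset.filter_mem_eq_inter, Finset.inter_eq_right.2 (Finset.mem_powerset.1 hU)]

/-- Alternating sums of powers only retain the words in which every letter of `s` occurs, so they
are monotone in the size of the letters. -/
theorem norm_altSum_pow_le {A : Type*} [NormedRing A] [NormOneClass A] {a : ι → A} {r : ι → ℝ}
    (n : ℕ) (s : Finset ι) (har : ∀ i ∈ s, ‖a i‖ ≤ r i) :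
    ‖altSum (fun U => (∑ i ∈ U, a i) ^ n) s‖ ≤ altSum (fun U => (∑ i ∈ U, r i) ^ n) s := by
  induction n generalizing s with
  | zero =>
    rcases s.eq_empty_or_nonempty with rfl | ⟨i, hi⟩
    · simp
    · rw [← Finset.insert_erase hi, altSum_insert _ (Finset.notMem_erase i s),
        altSum_insert _ (Finset.notMem_erase i s)]
      simp
  | succ n ih =>
    simp only [pow_succ']
    rw [altSum_sum_mul, altSum_sum_mul]
    refine (norm_sum_le _ _).trans (Finset.sum_le_sum fun i hi => (norm_mul_le _ _).trans ?_)
    have h1 := ih s har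
    have h2 := ih (s.erase i) fun j hj => har j (Finset.mem_of_mem_erase hj)
    exact mul_le_mul (har i hi) ((norm_add_le _ _).trans (add_le_add h1 h2)) (norm_nonneg _)
      ((norm_nonneg _).trans (har i hi))

theorem altSum_exp_sum_real (r : ι → ℝ) (s : Finset ι) :
    altSum (fun U => Real.exp (∑ i ∈ U, r i)) s = ∏ i ∈ s, (Real.exp (r i) - 1) := by
  induction s using Finset.induction_on with
  | empty => simp
  | insert a s ha ih =>
    rw [altSum_insert _ ha, Finset.prod_insert ha, ← ih, sub_mul, one_mul, ← altSum_mul_left]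
    congr 1
    refine altSum_congr fun U hU => ?_
    rw [Finset.sum_insert fun h => ha (hU h), Real.exp_add]

theorem hasSum_altSum {E : Type*} [NormedAddCommGroup E] {f : ℕ → Finset ι → E} {F : Finset ι → E}
    (h : ∀ U, HasSum (fun n => f n U) (F U)) (s : Finset ι) :
    HasSum (fun n => altSum (f n) s) (altSum F s) :=
  hasSum_sum fun U _ => (h U).const_smul _

theorem altSum_smul {𝕜 E : Type*} [Ring 𝕜] [AddCommGroup E] [Module 𝕜 E] (c : 𝕜)
    (F : Finset ι → E) (s : Finset ι) : altSum (fun U => c • F U) s = c • altSum F s := by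
  unfold altSum
  rw [Finset.smul_sum]
  exact Finset.sum_congr rfl fun U _ => smul_comm _ _ _

theorem norm_altSum_exp_le {A : Type*} [NormedRing A] [NormOneClass A] [NormedAlgebra ℂ A]
    [CompleteSpace A] {a : ι → A} {r : ι → ℝ} (s : Finset ι) (har : ∀ i ∈ s, ‖a i‖ ≤ r i) :
    ‖altSum (fun U => NormedSpace.exp (∑ i ∈ U, a i)) s‖ ≤ ∏ i ∈ s, (Real.exp (r i) - 1) := by
  have h1 := hasSum_altSum (s := s) fun U : Finset ι =>
    NormedSpace.exp_series_hasSum_exp' (𝕂 := ℂ) (∑ i ∈ U, a i)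
  have h2 := hasSum_altSum (s := s) fun U : Finset ι =>
    NormedSpace.exp_series_hasSum_exp' (𝕂 := ℝ) (∑ i ∈ U, r i)
  simp only [← Real.exp_eq_exp_ℝ] at h2
  rw [altSum_exp_sum_real] at h2
  refine h1.norm_le_of_bounded h2 fun n => ?_
  rw [altSum_smul, altSum_smul, norm_smul, smul_eq_mul, norm_inv, Complex.norm_natCast]
  exact mul_le_mul_of_nonneg_left (norm_altSum_pow_le n s har) (by positivity)

end AltSumExp

/-! ### Polymers: vertex sets connected to a root set -/

namespace SimpleGraph

variable {ι : Type*} [DecidableEq ι] (G : SimpleGraph ι)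

/-- `δ` is closed under passing to `G`-neighbours inside `γ`. -/
def ClosedIn (γ δ : Finset ι) : Prop :=
  ∀ v ∈ δ, ∀ w ∈ γ, G.Adj v w → w ∈ δ

/-- `γ` contains `B`, and every vertex of `γ` is connected to `B` inside `γ`. The connectedness is
expressed without walks: no proper subset of `γ` that contains `B` is closed under passing to
neighbours. For `B = {X}` these are the connected sets (polymers) containing `X`. -/
def Rooted (B γ : Finset ι) : Prop :=
  B ⊆ γ ∧ ∀ δ ⊆ γ, B ⊆ δ → G.ClosedIn γ δ → δ = γ

variable {G}

/-- Deleting a root `b` leaves a set rooted at the other roots and the neighbours of `b`. -/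
theorem Rooted.erase [Fintype ι] [DecidableRel G.Adj] {B γ : Finset ι} {b : ι}
    (h : G.Rooted B γ) (hb : b ∈ B) :
    G.Rooted (B.erase b ∪ ((G.neighborFinset b \ B) ∩ γ)) (γ.erase b) := by
  have hbγ := h.1 hb
  constructor
  · intro v hv
    simp only [Finset.mem_union, Finset.mem_erase, Finset.mem_inter, Finset.mem_sdiff] at hv ⊢
    rcases hv with hv | hv
    · exact ⟨hv.1, h.1 hv.2⟩
    · exact ⟨fun e => hv.1.2 (e ▸ hb), hv.2⟩
  · intro δ hδ hB hcl
    have key : insert b δ = γ := by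
      refine h.2 _ ?_ ?_ ?_
      · exact Finset.insert_subset hbγ (hδ.trans (Finset.erase_subset _ _))
      · intro v hv
        by_cases e : v = b
        · simp [e]
        · exact Finset.mem_insert_of_mem (hB (by simp [e, hv]))
      · intro v hv w hw hvw
        by_cases e : w = b
        · simp [e]
        refine Finset.mem_insert_of_mem ?_
        rcases Finset.mem_insert.1 hv with rfl | hv
        · refine hB ?_
          by_cases hwB : w ∈ B
          · simp [e, hwB]
          · simp [hwB, hw, hvw]
        · exact hcl v hv w (Finset.mem_erase.2 ⟨e, hw⟩) hvw
    have hbδ : b ∉ δ := fun hh => Finset.notMem_erase b γ (hδ hh)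
    rw [← key, Finset.erase_insert hbδ]

open Classical in
/-- The generating function of the sets rooted at `B` is at most `ε ^ |B|` as soon as `ε` is a
supersolution of the tree recursion `ε = x (1 + ε) ^ D`. -/
theorem sum_rooted_le [Fintype ι] [DecidableRel G.Adj] {D : ℕ} (hD : ∀ v, (G.neighborFinset v).card ≤ D) {x ε : ℝ}
    (hx : 0 ≤ x) (hε : 0 ≤ ε) (hxε : x * (1 + ε) ^ D ≤ ε) (T B : Finset ι) :
    ∑ γ ∈ T.powerset with G.Rooted B γ, x ^ γ.card ≤ ε ^ B.card := by
  induction hn : T.card generalizing T B with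
  | zero =>
    obtain rfl := Finset.card_eq_zero.1 hn
    rcases B.eq_empty_or_nonempty with rfl | hB
    · exact (Finset.sum_le_sum_of_subset_of_nonneg (Finset.filter_subset _ _)
        fun _ _ _ => by positivity).trans (by simp)
    · rw [Finset.filter_false_of_mem, Finset.sum_empty]
      · positivity
      · intro γ hγ hR
        have := hR.1.trans (Finset.mem_powerset.1 hγ)
        exact hB.ne_empty (Finset.subset_empty.1 this)
  | succ n ih =>
    rcases B.eq_empty_or_nonempty with rfl | ⟨b, hb⟩
    · -- only the empty set is rooted at the empty set
      refine (Finset.sum_le_sum_of_subset_of_nonneg (t := {∅}) ?_ fun _ _ _ => by positivity).trans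
        (by simp)
      intro γ hγ
      have h := (Finset.mem_filter.1 hγ).2
      have := h.2 ∅ (Finset.empty_subset _) subset_rfl (by simp [ClosedIn])
      simp [← this]
    by_cases hbT : b ∈ T
    swap
    · rw [Finset.filter_false_of_mem, Finset.sum_empty]
      · positivity
      · intro γ hγ hR
        exact hbT (Finset.mem_powerset.1 hγ (hR.1 hb))
    set N := G.neighborFinset b \ B with hN
    have hNcard : N.card ≤ D := (Finset.card_le_card Finset.sdiff_subset).trans (hD b)
    -- split according to the set `A` of neighbours of `b` outside `B` that belong to `γ`
    have hmaps : ∀ γ ∈ T.powerset.filter (G.Rooted B), N ∩ γ ∈ N.powerset := fun γ _ =>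
      Finset.mem_powerset.2 Finset.inter_subset_left
    rw [← Finset.sum_fiberwise_of_maps_to hmaps]
    have hfib : ∀ A ∈ N.powerset,
        ∑ γ ∈ T.powerset.filter (G.Rooted B) with N ∩ γ = A, x ^ γ.card
          ≤ x * ε ^ (B.erase b ∪ A).card := by
      intro A _
      refine le_trans ?_ (mul_le_mul_of_nonneg_left
        (ih (T.erase b) (B.erase b ∪ A) (by rw [Finset.card_erase_of_mem hbT, hn]; rfl)) hx)
      rw [Finset.mul_sum]
      refine le_trans (le_of_eq ?_) (Finset.sum_le_sum_of_subset_of_nonneg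
        (s := (((T.powerset.filter (G.Rooted B)).filter fun γ => N ∩ γ = A).image
          fun γ => γ.erase b)) ?_ fun _ _ _ => by positivity)
      · rw [Finset.sum_image]
        · refine Finset.sum_congr rfl fun γ hγ => ?_
          have hbγ := (Finset.mem_filter.1 (Finset.mem_filter.1 hγ).1).2.1 hb
          rw [← Finset.card_erase_add_one hbγ, pow_succ']
        · intro γ hγ γ' hγ' h
          have hbγ := (Finset.mem_filter.1 (Finset.mem_filter.1 hγ).1).2.1 hb
          have hbγ' := (Finset.mem_filter.1 (Finset.mem_filter.1 hγ').1).2.1 hb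
          simp only at h
          rw [← Finset.insert_erase hbγ, h, Finset.insert_erase hbγ']
      · intro γ' hγ'
        obtain ⟨γ, hγ, rfl⟩ := Finset.mem_image.1 hγ'
        obtain ⟨hγ₁, rfl⟩ := Finset.mem_filter.1 hγ
        obtain ⟨hγT, hR⟩ := Finset.mem_filter.1 hγ₁
        refine Finset.mem_filter.2 ⟨Finset.mem_powerset.2
          (Finset.erase_subset_erase b (Finset.mem_powerset.1 hγT)), ?_⟩
        exact hR.erase hb
    refine (Finset.sum_le_sum hfib).trans ?_
    have hcard : ∀ A ∈ N.powerset, x * ε ^ (B.erase b ∪ A).card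
        = x * ε ^ (B.card - 1) * ε ^ A.card := by
      intro A hA
      rw [Finset.card_union_of_disjoint, Finset.card_erase_of_mem hb, pow_add, mul_assoc]
      refine Finset.disjoint_left.2 fun v hv hvA => ?_
      exact (Finset.mem_sdiff.1 (Finset.mem_powerset.1 hA hvA)).2 (Finset.mem_of_mem_erase hv)
    rw [Finset.sum_congr rfl hcard, ← Finset.mul_sum]
    have hbin : ∑ A ∈ N.powerset, ε ^ A.card = (1 + ε) ^ N.card := by
      have := Finset.sum_pow_mul_eq_add_pow ε 1 N
      simpa [add_comm] using this
    rw [hbin]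
    have hB1 : B.card = B.card - 1 + 1 := by
      have := Finset.card_pos.2 ⟨b, hb⟩
      omega
    calc x * ε ^ (B.card - 1) * (1 + ε) ^ N.card
        ≤ x * ε ^ (B.card - 1) * (1 + ε) ^ D := by
          gcongr
          linarith
      _ = ε ^ (B.card - 1) * (x * (1 + ε) ^ D) := by ring
      _ ≤ ε ^ (B.card - 1) * ε := by gcongr
      _ = ε ^ B.card := by rw [← pow_succ, ← hB1]

variable (G) in
/-- The vertices of `γ` and their neighbours. -/
def closedNbhd [Fintype ι] [DecidableRel G.Adj] (γ : Finset ι) : Finset ι :=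
  γ.biUnion fun v => insert v (G.neighborFinset v)

theorem mem_closedNbhd [Fintype ι] [DecidableRel G.Adj] {γ : Finset ι} {w : ι} :
    w ∈ G.closedNbhd γ ↔ w ∈ γ ∨ ∃ v ∈ γ, G.Adj v w := by
  simp only [closedNbhd, Finset.mem_biUnion, Finset.mem_insert, mem_neighborFinset]
  constructor
  · rintro ⟨v, hv, rfl | h⟩
    exacts [Or.inl hv, Or.inr ⟨v, hv, h⟩]
  · rintro (h | ⟨v, hv, h⟩)
    exacts [⟨w, h, Or.inl rfl⟩, ⟨v, hv, Or.inr h⟩]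

theorem card_closedNbhd_le [Fintype ι] [DecidableRel G.Adj] {D : ℕ}
    (hD : ∀ v, (G.neighborFinset v).card ≤ D) (γ : Finset ι) :
    (G.closedNbhd γ).card ≤ γ.card * (D + 1) :=
  Finset.card_biUnion_le_card_mul _ _ _ fun v _ =>
    (Finset.card_insert_le _ _).trans (Nat.succ_le_succ (hD v))

theorem Rooted.subset_of_union_eq {X : ι} {γ γ' δ δ' : Finset ι} (h : G.Rooted {X} γ)
    (hX : X ∈ γ') (hδ' : ∀ v ∈ γ', ∀ w ∈ δ', ¬ G.Adj v w) (he : γ ∪ δ = γ' ∪ δ') : γ ⊆ γ' := by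
  have := h.2 (γ ∩ γ') Finset.inter_subset_left
    (by simpa using ⟨h.1 (Finset.mem_singleton_self X), hX⟩) ?_
  · exact Finset.inter_eq_left.1 this
  · intro v hv w hw hvw
    obtain ⟨_, hv⟩ := Finset.mem_inter.1 hv
    have hw' : w ∈ γ' ∪ δ' := he ▸ Finset.mem_union_left _ hw
    rcases Finset.mem_union.1 hw' with h1 | h1
    · exact Finset.mem_inter.2 ⟨hw, h1⟩
    · exact absurd hvw (hδ' v hv w h1)

/-- The connected component of `X` in `Γ`. -/
theorem exists_rooted_closedIn {X : ι} {Γ : Finset ι} (hX : X ∈ Γ) :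
    ∃ γ ⊆ Γ, G.Rooted {X} γ ∧ G.ClosedIn Γ γ := by
  classical
  set γ := Γ.filter fun v => ∀ δ ⊆ Γ, X ∈ δ → G.ClosedIn Γ δ → v ∈ δ with hγ
  have hcl : G.ClosedIn Γ γ := by
    intro v hv w hw hvw
    refine Finset.mem_filter.2 ⟨hw, fun δ h1 h2 h3 => ?_⟩
    exact h3 v ((Finset.mem_filter.1 hv).2 δ h1 h2 h3) w hw hvw
  have hsub : γ ⊆ Γ := Finset.filter_subset _ _
  refine ⟨γ, hsub, ⟨?_, ?_⟩, hcl⟩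
  · rw [Finset.singleton_subset_iff]
    exact Finset.mem_filter.2 ⟨hX, fun δ _ h _ => h⟩
  · intro δ hδ hXδ hclδ
    refine hδ.antisymm fun v hv => (Finset.mem_filter.1 hv).2 δ (hδ.trans hsub)
      (Finset.singleton_subset_iff.1 hXδ) ?_
    intro a ha w hw haw
    exact hclδ a ha w (hcl a (hδ ha) w hw haw) haw

open Classical in
/-- Sets containing `X` correspond to the component `γ` of `X` and a set away from `γ`. -/
theorem sum_powerset_mem_eq [Fintype ι] [DecidableRel G.Adj] {M : Type*} [AddCommMonoid M] (W : Finset ι → M)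
    (T : Finset ι) (X : ι) :
    ∑ Γ ∈ T.powerset with X ∈ Γ, W Γ
      = ∑ γ ∈ T.powerset with G.Rooted {X} γ, ∑ δ ∈ (T \ G.closedNbhd γ).powerset, W (γ ∪ δ) := by
  rw [Finset.sum_sigma']
  symm
  have hna : ∀ γ δ : Finset ι, δ ⊆ T \ G.closedNbhd γ → ∀ v ∈ γ, ∀ w ∈ δ, ¬ G.Adj v w := by
    intro γ δ h v hv w hw hvw
    exact (Finset.mem_sdiff.1 (h hw)).2 (mem_closedNbhd.2 (Or.inr ⟨v, hv, hvw⟩))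
  have hdj : ∀ γ δ : Finset ι, δ ⊆ T \ G.closedNbhd γ → Disjoint γ δ := fun γ δ h =>
    Finset.disjoint_left.2 fun v hv hw =>
      (Finset.mem_sdiff.1 (h hw)).2 (mem_closedNbhd.2 (Or.inl hv))
  refine Finset.sum_bij (fun p _ => p.1 ∪ p.2) ?_ ?_ ?_ fun _ _ => rfl
  · rintro ⟨γ, δ⟩ h
    simp only [Finset.mem_sigma, Finset.mem_filter, Finset.mem_powerset] at h ⊢
    exact ⟨Finset.union_subset h.1.1 (h.2.trans Finset.sdiff_subset),
      Finset.mem_union_left _ (h.1.2.1 (Finset.mem_singleton_self X))⟩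
  · rintro ⟨γ, δ⟩ h ⟨γ', δ'⟩ h' he
    simp only [Finset.mem_sigma, Finset.mem_filter, Finset.mem_powerset] at h h' he
    have e : γ = γ' := (h.1.2.subset_of_union_eq (h'.1.2.1 (Finset.mem_singleton_self X))
      (hna _ _ h'.2) he).antisymm (h'.1.2.subset_of_union_eq
        (h.1.2.1 (Finset.mem_singleton_self X)) (hna _ _ h.2) he.symm)
    subst e
    have e' : δ = δ' := by
      rw [← Finset.union_sdiff_cancel_left (hdj _ _ h.2), he,
        Finset.union_sdiff_cancel_left (hdj _ _ h'.2)]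
    rw [e']
  · intro Γ hΓ
    simp only [Finset.mem_filter, Finset.mem_powerset] at hΓ
    obtain ⟨γ, hγΓ, hR, hcl⟩ := exists_rooted_closedIn (G := G) hΓ.2
    refine ⟨⟨γ, Γ \ γ⟩, ?_, Finset.union_sdiff_of_subset hγΓ⟩
    simp only [Finset.mem_sigma, Finset.mem_filter, Finset.mem_powerset]
    refine ⟨⟨hγΓ.trans hΓ.1, hR⟩, fun w hw => ?_⟩
    obtain ⟨hw, hwγ⟩ := Finset.mem_sdiff.1 hw
    refine Finset.mem_sdiff.2 ⟨hΓ.1 hw, fun hn => ?_⟩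
    rcases mem_closedNbhd.1 hn with h | ⟨v, hv, hvw⟩
    exacts [hwγ h, hwγ (hcl v hv w hw hvw)]

/-! ### Zero-freeness of multiplicative set functions with small Möbius transform -/

section ZeroFree

variable [Fintype ι] {Z : Finset ι → ℂ}

open Classical in
/-- The polymer recursion. -/
theorem sub_erase_eq_sum_rooted [DecidableRel G.Adj]
    (hmul : ∀ s t, Disjoint s t → (∀ v ∈ s, ∀ w ∈ t, ¬ G.Adj v w) → Z (s ∪ t) = Z s * Z t)
    (T : Finset ι) (X : ι) :
    Z T - Z (T.erase X)
      = ∑ γ ∈ T.powerset with G.Rooted {X} γ, altSum Z γ * Z (T \ G.closedNbhd γ) := by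
  have h1 : Z T - Z (T.erase X) = ∑ Γ ∈ T.powerset with X ∈ Γ, altSum Z Γ := by
    rw [← sum_powerset_altSum Z T, ← sum_powerset_altSum Z (T.erase X), sub_eq_iff_eq_add,
      ← Finset.sum_filter_add_sum_filter_not T.powerset (fun Γ => X ∈ Γ)]
    congr 2
    ext Γ
    simp only [Finset.mem_filter, Finset.mem_powerset, Finset.subset_erase]
  rw [h1, sum_powerset_mem_eq (G := G)]
  refine Finset.sum_congr rfl fun γ _ => ?_
  rw [← sum_powerset_altSum Z (T \ G.closedNbhd γ), Finset.mul_sum]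
  refine Finset.sum_congr rfl fun δ hδ => ?_
  rw [Finset.mem_powerset] at hδ
  have hd : Disjoint γ δ := Finset.disjoint_left.2 fun v hv hw =>
      (Finset.mem_sdiff.1 (hδ hw)).2 (mem_closedNbhd.2 (Or.inl hv))
  refine altSum_union Z hd fun U hU U' hU' => hmul U U'
    (Finset.disjoint_of_subset_left hU (Finset.disjoint_of_subset_right hU' hd)) ?_
  intro v hv w hw hvw
  exact (Finset.mem_sdiff.1 (hδ (hU' hw))).2 (mem_closedNbhd.2 (Or.inr ⟨v, hU hv, hvw⟩))

/-- A Dobrushin-type induction on the polymer recursion: removing one vertex changes `Z` by a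
relative amount of at most `ε`. -/
theorem ne_zero_and_norm_sub_erase_le [DecidableRel G.Adj] {D : ℕ}
    (hD : ∀ v, (G.neighborFinset v).card ≤ D)
    (hmul : ∀ s t, Disjoint s t → (∀ v ∈ s, ∀ w ∈ t, ¬ G.Adj v w) → Z (s ∪ t) = Z s * Z t)
    (hempty : Z ∅ = 1) {u ε : ℝ} (hu : 0 ≤ u) (hε : 0 ≤ ε) (hε1 : ε < 1)
    (hW : ∀ s, ‖altSum Z s‖ ≤ u ^ s.card)
    (huε : u * ((1 - ε)⁻¹) ^ (D + 1) * (1 + ε) ^ D ≤ ε) (T : Finset ι) :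
    Z T ≠ 0 ∧ ∀ X ∈ T, ‖Z T - Z (T.erase X)‖ ≤ ε * ‖Z (T.erase X)‖ := by
  classical
  induction hn : T.card using Nat.strong_induction_on generalizing T with
  | _ n ih =>
  subst hn
  have hq : 1 ≤ (1 - ε)⁻¹ := (one_le_inv₀ (by linarith)).2 (by linarith)
  have hq0 : 0 < 1 - ε := by linarith
  -- iterating the induction hypothesis compares `Z U` with `Z S` for `U ⊆ S`
  have hcmp : ∀ (S : Finset ι), S.card < T.card → ∀ U ⊆ S,
      ‖Z U‖ ≤ ((1 - ε)⁻¹) ^ (S \ U).card * ‖Z S‖ := by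
    intro S hS
    induction S using Finset.strongInduction with
    | H S ihS =>
      intro U hU
      rcases hU.eq_or_ssubset with rfl | hss
      · simp
      obtain ⟨a, haS, haU⟩ := Finset.exists_of_ssubset hss
      have hlt := Finset.card_erase_lt_of_mem haS
      have h1 := ihS (S.erase a) (Finset.erase_ssubset haS) (hlt.trans hS) U
        (Finset.subset_erase.2 ⟨hU, haU⟩)
      have h2 := (ih S.card hS S rfl).2 a haS
      have h3 : (1 - ε) * ‖Z (S.erase a)‖ ≤ ‖Z S‖ := by
        have := norm_sub_norm_le (Z (S.erase a)) (Z S)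
        rw [norm_sub_rev] at this
        linarith
      have h4 : ‖Z (S.erase a)‖ ≤ (1 - ε)⁻¹ * ‖Z S‖ := by
        rw [inv_mul_eq_div, le_div_iff₀ hq0]; linarith
      have h5 : (S \ U).card = (S.erase a \ U).card + 1 := by
        rw [Finset.erase_sdiff_comm, Finset.card_erase_add_one]
        exact Finset.mem_sdiff.2 ⟨haS, haU⟩
      rw [h5, pow_succ, mul_assoc]
      exact h1.trans (by gcongr)
  have hmain : ∀ X ∈ T, ‖Z T - Z (T.erase X)‖ ≤ ε * ‖Z (T.erase X)‖ := by
    intro X hX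
    rw [sub_erase_eq_sum_rooted hmul]
    have hterm : ∀ γ ∈ T.powerset.filter (G.Rooted {X}),
        ‖altSum Z γ * Z (T \ G.closedNbhd γ)‖
          ≤ (u * ((1 - ε)⁻¹) ^ (D + 1)) ^ γ.card * ‖Z (T.erase X)‖ := by
      intro γ hγ
      have hXγ : X ∈ γ := (Finset.mem_filter.1 hγ).2.1 (Finset.mem_singleton_self X)
      have hsub : T \ G.closedNbhd γ ⊆ T.erase X := Finset.subset_erase.2
        ⟨Finset.sdiff_subset, fun h => (Finset.mem_sdiff.1 h).2 (mem_closedNbhd.2 (Or.inl hXγ))⟩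
      have h1 := hcmp (T.erase X) (Finset.card_erase_lt_of_mem hX) _ hsub
      have h2 : (T.erase X \ (T \ G.closedNbhd γ)).card ≤ (D + 1) * γ.card := by
        rw [mul_comm]
        refine (Finset.card_le_card fun v hv => ?_).trans (card_closedNbhd_le hD γ)
        simp only [Finset.mem_sdiff, Finset.mem_erase, not_and, not_not] at hv
        exact hv.2 hv.1.2
      rw [norm_mul, mul_pow, ← pow_mul, mul_assoc]
      refine mul_le_mul (hW γ) (h1.trans ?_) (norm_nonneg _) (by positivity)
      gcongr
    refine (norm_sum_le _ _).trans ((Finset.sum_le_sum hterm).trans ?_)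
    rw [← Finset.sum_mul]
    refine mul_le_mul_of_nonneg_right ?_ (norm_nonneg _)
    simpa using sum_rooted_le hD (by positivity) hε huε T {X}
  refine ⟨?_, hmain⟩
  rcases T.eq_empty_or_nonempty with rfl | ⟨X, hX⟩
  · simp [hempty]
  · intro h0
    have h1 := hmain X hX
    have h2 := (ih _ (Finset.card_erase_lt_of_mem hX) _ rfl).1
    rw [h0, zero_sub, norm_neg] at h1
    have := norm_pos_iff.2 h2
    nlinarith

end ZeroFree

end SimpleGraph

noncomputable section
/-! ### Product states and operators on disjoint sets of spins -/

namespace SpinSystem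

open scoped Matrix Kronecker

variable {V : Type*} [Fintype V] [DecidableEq V] {d : ℕ}

/-- The operator `a ⊗ b` on `⨂_{v ∈ V} ℂ^d`, for `a` acting on the spins in `P` and `b` acting on
the spins outside `P`. -/
def bipartite (P : Finset V) (a : Operator P d) (b : Operator {v // v ∉ P} d) : Operator V d :=
  (a ⊗ₖ b).submatrix (Equiv.piEquivPiSubtypeProd (· ∈ P) fun _ => Fin d)
    (Equiv.piEquivPiSubtypeProd (· ∈ P) fun _ => Fin d)

section Bipartite

variable {P : Finset V}

omit [Fintype V] in
theorem bipartite_apply (a : Operator P d) (b : Operator {v // v ∉ P} d) (s s' : V → Fin d) :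
    bipartite P a b s s' = a (fun v => s v) (fun v => s' v) * b (fun v => s v) (fun v => s' v) :=
  rfl

theorem bipartite_mul (a a' : Operator P d) (b b' : Operator {v // v ∉ P} d) :
    bipartite P a b * bipartite P a' b' = bipartite P (a * a') (b * b') := by
  unfold bipartite
  rw [Matrix.submatrix_mul_equiv, ← Matrix.mul_kronecker_mul]

/-- The embedding `a ↦ a ⊗ 1`. -/
def embedLeft (P : Finset V) : Operator P d →+* Operator V d where
  toFun a := bipartite P a 1
  map_one' := by simp [bipartite]
  map_zero' := by simp [bipartite]
  map_add' a b := by simp [bipartite, Matrix.add_kronecker, Matrix.submatrix_add]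
  map_mul' a b := by rw [bipartite_mul, one_mul]

/-- The embedding `b ↦ 1 ⊗ b`. -/
def embedRight (P : Finset V) : Operator {v // v ∉ P} d →+* Operator V d where
  toFun b := bipartite P 1 b
  map_one' := by simp [bipartite]
  map_zero' := by simp [bipartite]
  map_add' a b := by simp [bipartite, Matrix.kronecker_add, Matrix.submatrix_add]
  map_mul' a b := by rw [bipartite_mul, one_mul]

theorem embedLeft_mul_embedRight (a : Operator P d) (b : Operator {v // v ∉ P} d) :
    embedLeft P a * embedRight P b = bipartite P a b :=
  (bipartite_mul _ _ _ _).trans (by rw [one_mul, mul_one])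

theorem commute_embedLeft_embedRight (a : Operator P d) (b : Operator {v // v ∉ P} d) :
    Commute (embedLeft P a) (embedRight P b) :=
  (embedLeft_mul_embedRight a b).trans
    ((bipartite_mul _ _ _ _).trans (by rw [one_mul, mul_one])).symm

theorem exp_embedLeft (a : Operator P d) :
    NormedSpace.exp (embedLeft P a) = embedLeft P (NormedSpace.exp a) := by
  open scoped Matrix.Norms.L2Operator in
  let _ : NormedAlgebra ℚ (Operator P d) := NormedAlgebra.restrictScalars ℚ ℂ _
  refine (NormedSpace.map_exp (embedLeft P) ?_ a).symm
  refine continuous_matrix fun s s' => ?_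
  exact (continuous_id.matrix_elem _ _).mul continuous_const

theorem exp_embedRight (b : Operator {v // v ∉ P} d) :
    NormedSpace.exp (embedRight P b) = embedRight P (NormedSpace.exp b) := by
  open scoped Matrix.Norms.L2Operator in
  let _ : NormedAlgebra ℚ (Operator {v // v ∉ P} d) := NormedAlgebra.restrictScalars ℚ ℂ _
  refine (NormedSpace.map_exp (embedRight P) ?_ b).symm
  refine continuous_matrix fun s s' => ?_
  exact continuous_const.mul (continuous_id.matrix_elem _ _)

theorem ActsOn.exists_embedLeft {A : Operator V d} {X : Finset V} (hA : ActsOn A X) (hX : X ⊆ P) :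
    ∃ a, A = embedLeft P a := by
  obtain ⟨a, ha⟩ := hA
  refine ⟨Matrix.of fun s s' => if ∀ v : P, (v : V) ∉ X → s v = s' v then
    a (fun v => s ⟨v, hX v.2⟩) (fun v => s' ⟨v, hX v.2⟩) else 0, ?_⟩
  ext s s'
  change _ = bipartite P _ 1 s s'
  rw [ha, bipartite_apply, Matrix.one_apply, Matrix.of_apply]
  by_cases h : ∀ v, v ∉ X → s v = s' v
  · have h1 : ∀ v : P, (v : V) ∉ X → s v = s' v := fun v hv => h v hv
    have h2 : (fun v : {v // v ∉ P} => s v) = fun v : {v // v ∉ P} => s' v :=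
      funext fun v => h v fun hv => v.2 (hX hv)
    rw [if_pos h, if_pos h1, if_pos h2, mul_one]
  · rw [if_neg h]
    by_cases h1 : (fun v : {v // v ∉ P} => s v) = fun v : {v // v ∉ P} => s' v
    · rw [if_neg, zero_mul]
      refine fun h2 => h fun v hv => ?_
      by_cases hvP : v ∈ P
      exacts [h2 ⟨v, hvP⟩ hv, congrFun h1 ⟨v, hvP⟩]
    · rw [if_neg h1, mul_zero]

theorem ActsOn.exists_embedRight {A : Operator V d} {X : Finset V} (hA : ActsOn A X)
    (hX : Disjoint X P) : ∃ b, A = embedRight P b := by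
  obtain ⟨a, ha⟩ := hA
  have hX' : ∀ v ∈ X, v ∉ P := fun v hv => Finset.disjoint_left.1 hX hv
  refine ⟨Matrix.of fun s s' => if ∀ v : {v // v ∉ P}, (v : V) ∉ X → s v = s' v then
    a (fun v => s ⟨v, hX' v v.2⟩) (fun v => s' ⟨v, hX' v v.2⟩) else 0, ?_⟩
  ext s s'
  change _ = bipartite P 1 _ s s'
  rw [ha, bipartite_apply, Matrix.one_apply, Matrix.of_apply]
  by_cases h : ∀ v, v ∉ X → s v = s' v
  · have h1 : ∀ v : {v // v ∉ P}, (v : V) ∉ X → s v = s' v := fun v hv => h v hv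
    have h2 : (fun v : P => s v) = fun v : P => s' v :=
      funext fun v => h v fun hv => hX' v hv v.2
    rw [if_pos h, if_pos h1, if_pos h2, one_mul]
  · rw [if_neg h]
    by_cases h1 : (fun v : P => s v) = fun v : P => s' v
    · rw [if_pos h1, one_mul, if_neg]
      refine fun h2 => h fun v hv => ?_
      by_cases hvP : v ∈ P
      exacts [congrFun h1 ⟨v, hvP⟩, h2 ⟨v, hvP⟩ hv]
    · rw [if_neg h1, zero_mul]

end Bipartite

theorem expectation_eq_sum (A : Operator V d) (Φ : StateVector V d) :
    expectation A Φ = ∑ s, ∑ s', star (Φ s) * A s s' * Φ s' := by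
  simp only [expectation, dotProduct, Matrix.mulVec, Pi.star_apply, Finset.mul_sum, mul_assoc]

/-- The product state with factors `φ`. -/
def productState {W : Type*} [Fintype W] (φ : W → Fin d → ℂ) : StateVector W d :=
  fun s => ∏ v, φ v (s v)

theorem expectation_bipartite {P : Finset V} (φ : V → Fin d → ℂ) (a : Operator P d)
    (b : Operator {v // v ∉ P} d) :
    expectation (bipartite P a b) (productState φ)
      = expectation a (productState fun v : P => φ v)
        * expectation b (productState fun v : {v // v ∉ P} => φ v) := by
  have hΦ : ∀ s : V → Fin d, productState φ s = (productState fun v : P => φ v) (fun v => s v)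
      * (productState fun v : {v // v ∉ P} => φ v) (fun v => s v) := fun s => by
    unfold productState
    convert (Fintype.prod_subtype_mul_prod_subtype (· ∈ P) fun v => φ v (s v)).symm
  set e := Equiv.piEquivPiSubtypeProd (· ∈ P) fun _ => Fin d with he
  have key : ∀ F : (P → Fin d) × ({v // v ∉ P} → Fin d) →
      (P → Fin d) × ({v // v ∉ P} → Fin d) → ℂ,
      ∑ s, ∑ s', F (e s) (e s') = ∑ p₁, ∑ p₂, ∑ q₁, ∑ q₂, F (p₁, p₂) (q₁, q₂) := by
    intro F
    rw [e.sum_comp fun p => ∑ s', F p (e s'), Fintype.sum_prod_type]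
    refine Finset.sum_congr rfl fun p₁ _ => Finset.sum_congr rfl fun p₂ _ => ?_
    rw [e.sum_comp, Fintype.sum_prod_type]
  rw [expectation_eq_sum, expectation_eq_sum, expectation_eq_sum, Finset.sum_mul_sum]
  refine Eq.trans ?_ ((key fun p q => star ((productState fun v : P => φ v) p.1
    * (productState fun v : {v // v ∉ P} => φ v) p.2) * (a p.1 q.1 * b p.2 q.2)
    * ((productState fun v : P => φ v) q.1
    * (productState fun v : {v // v ∉ P} => φ v) q.2)).trans ?_)
  · refine Finset.sum_congr rfl fun s _ => Finset.sum_congr rfl fun s' _ => ?_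
    rw [hΦ, hΦ, bipartite_apply]
    rfl
  · refine Finset.sum_congr rfl fun p₁ _ => Finset.sum_congr rfl fun p₂ _ => ?_
    rw [Finset.sum_mul_sum]
    refine Finset.sum_congr rfl fun q₁ _ => Finset.sum_congr rfl fun q₂ _ => ?_
    rw [star_mul']
    ring

theorem sum_norm_sq_productState {W : Type*} [Fintype W] [DecidableEq W] {φ : W → Fin d → ℂ}
    (hφ : ∀ v, ∑ i, ‖φ v i‖ ^ 2 = 1) : ∑ s, ‖productState φ s‖ ^ 2 = 1 := by
  simp only [productState, norm_prod, ← Finset.prod_pow]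
  rw [← Fintype.prod_sum fun v i => ‖φ v i‖ ^ 2]
  exact Finset.prod_eq_one fun v _ => hφ v

theorem expectation_one (Φ : StateVector V d) (hΦ : ∑ s, ‖Φ s‖ ^ 2 = 1) :
    expectation (1 : Operator V d) Φ = 1 := by
  simp only [expectation, Matrix.one_mulVec, dotProduct, Pi.star_apply]
  have : ∀ s, star (Φ s) * Φ s = ((‖Φ s‖ ^ 2 : ℝ) : ℂ) := fun s => by
    rw [Complex.ofReal_pow]
    exact Complex.conj_mul' (Φ s)
  rw [Finset.sum_congr rfl fun s _ => this s, ← Complex.ofReal_sum, hΦ, Complex.ofReal_one]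

/-- In a product state, exponentials of operators with disjoint supports are uncorrelated. -/
theorem expectation_exp_add {P : Finset V} {φ : V → Fin d → ℂ} (hφ : ∀ v, ∑ i, ‖φ v i‖ ^ 2 = 1)
    (a : Operator P d) (b : Operator {v // v ∉ P} d) :
    expectation (NormedSpace.exp (embedLeft P a + embedRight P b)) (productState φ)
      = expectation (NormedSpace.exp (embedLeft P a)) (productState φ)
        * expectation (NormedSpace.exp (embedRight P b)) (productState φ) := by
  rw [Matrix.exp_add_of_commute _ _ (commute_embedLeft_embedRight a b), exp_embedLeft,
    exp_embedRight, embedLeft_mul_embedRight]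
  change _ = expectation (bipartite P _ 1) _ * expectation (bipartite P 1 _) _
  rw [expectation_bipartite, expectation_bipartite, expectation_bipartite,
    expectation_one _ (sum_norm_sq_productState fun v : P => hφ v),
    expectation_one _ (sum_norm_sq_productState fun v : {v // v ∉ P} => hφ v), one_mul, mul_one]

/-! ### Expectation values as a bounded functional -/

theorem norm_expectation_le (A : Operator V d) {Φ : StateVector V d} (hΦ : ∑ s, ‖Φ s‖ ^ 2 = 1) :
    ‖expectation A Φ‖ ≤ opNorm A := by
  have h1 : ‖WithLp.toLp 2 Φ‖ = 1 := by
    rw [EuclideanSpace.norm_eq, hΦ, Real.sqrt_one]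
  have h2 : expectation A Φ
      = inner ℂ (WithLp.toLp 2 Φ) (Matrix.toEuclideanCLM (n := V → Fin d) (𝕜 := ℂ) A
        (WithLp.toLp 2 Φ)) := by
    rw [Matrix.toEuclideanCLM_toLp, EuclideanSpace.inner_toLp_toLp, dotProduct_comm]
    rfl
  rw [h2]
  refine (norm_inner_le_norm _ _).trans ?_
  rw [h1, one_mul]
  simpa [h1, opNorm] using
    (Matrix.toEuclideanCLM (n := V → Fin d) (𝕜 := ℂ) A).le_opNorm (WithLp.toLp 2 Φ)

/-- `A ↦ ⟨Φ| A |Φ⟩` as a linear functional. -/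
def expectationLM (Φ : StateVector V d) : Operator V d →ₗ[ℂ] ℂ where
  toFun A := expectation A Φ
  map_add' A B := by simp [expectation, Matrix.add_mulVec]
  map_smul' c A := by simp [expectation, Matrix.smul_mulVec]

theorem expectation_conjTranspose (A : Operator V d) (Φ : StateVector V d) :
    expectation Aᴴ Φ = star (expectation A Φ) := by
  rw [expectation_eq_sum, expectation_eq_sum, star_sum, Finset.sum_comm]
  refine Finset.sum_congr rfl fun s _ => ?_
  rw [star_sum]
  refine Finset.sum_congr rfl fun s' _ => ?_
  rw [Matrix.conjTranspose_apply, star_mul', star_mul', star_star]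
  ring

end SpinSystem
end

/-! ### Logarithms and even parts of Taylor series -/

section Logarithm

/-- A telescoping product of ratios close to `1` has an analytic logarithm: the sum of the principal
logarithms of the ratios. -/
theorem exists_log_of_norm_sub_erase_le {ι : Type*} [DecidableEq ι] {Z : Finset ι → ℂ → ℂ} {R : ℝ}
    (hZ : ∀ T, Differentiable ℂ (Z T)) (hempty : ∀ z, Z ∅ z = 1)
    (hzero : ∀ T, Z T 0 = 1)
    (hne : ∀ z ∈ Metric.closedBall (0 : ℂ) R, ∀ T, Z T z ≠ 0)
    (hle : ∀ z ∈ Metric.closedBall (0 : ℂ) R, ∀ T, ∀ X ∈ T,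
      ‖Z T z - Z (T.erase X) z‖ ≤ 1 / 2 * ‖Z (T.erase X) z‖) (T : Finset ι) :
    ∃ g : ℂ → ℂ, DifferentiableOn ℂ g (Metric.closedBall 0 R) ∧ g 0 = 0 ∧
      ∀ z ∈ Metric.closedBall (0 : ℂ) R, Complex.exp (g z) = Z T z ∧ ‖g z‖ ≤ T.card := by
  induction T using Finset.induction_on with
  | empty =>
    exact ⟨fun _ => 0, differentiableOn_const _, rfl, fun z _ => by simp [hempty]⟩
  | insert a T ha ih =>
    obtain ⟨g, hg, hg0, hgz⟩ := ih
    have hratio : ∀ z ∈ Metric.closedBall (0 : ℂ) R, ‖Z (insert a T) z / Z T z - 1‖ ≤ 1 / 2 := by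
      intro z hz
      have h1 := hle z hz (insert a T) a (Finset.mem_insert_self _ _)
      rw [Finset.erase_insert ha] at h1
      rw [div_sub_one (hne z hz T), norm_div, div_le_iff₀ (norm_pos_iff.2 (hne z hz T))]
      exact h1
    refine ⟨fun z => g z + Complex.log (Z (insert a T) z / Z T z), ?_, ?_, ?_⟩
    · refine hg.add (DifferentiableOn.clog ?_ fun z hz => ?_)
      · exact (hZ _).differentiableOn.div (hZ _).differentiableOn fun z hz => hne z hz T
      · refine Complex.ball_one_subset_slitPlane ?_
        rw [Metric.mem_ball, dist_eq_norm]
        exact (hratio z hz).trans_lt (by norm_num)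
    · simp [hg0, hzero]
    · intro z hz
      constructor
      · rw [Complex.exp_add, (hgz z hz).1,
          Complex.exp_log (div_ne_zero (hne z hz _) (hne z hz _)), mul_div_cancel₀ _ (hne z hz T)]
      · have h1 := Complex.norm_log_one_add_half_le_self (hratio z hz)
        rw [add_sub_cancel] at h1
        rw [Finset.card_insert_of_notMem ha]
        push_cast
        refine (norm_add_le _ _).trans (add_le_add (hgz z hz).2 (h1.trans ?_))
        linarith [hratio z hz]

/-- Second derivative of a logarithm, at a zero of the logarithm. -/
theorem iteratedDeriv_two_log {f g : ℂ → ℂ} {R : ℝ} (hR : 0 < R)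
    (hg : DifferentiableOn ℂ g (Metric.ball 0 R)) (hg0 : g 0 = 0)
    (hfg : ∀ z ∈ Metric.ball (0 : ℂ) R, Complex.exp (g z) = f z) :
    iteratedDeriv 2 g 0 = deriv (deriv f) 0 - deriv f 0 ^ 2 := by
  have hd : ∀ z ∈ Metric.ball (0 : ℂ) R, HasDerivAt f (f z * deriv g z) z := by
    intro z hz
    have hnhds := Metric.isOpen_ball.mem_nhds hz
    have h1 := ((hg z hz).differentiableAt hnhds).hasDerivAt.cexp
    rw [hfg z hz] at h1
    refine h1.congr_of_eventuallyEq ?_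
    filter_upwards [hnhds] with w hw
    exact (hfg w hw).symm
  have h0 : (0 : ℂ) ∈ Metric.ball (0 : ℂ) R := Metric.mem_ball_self hR
  have hf0 : f 0 = 1 := by rw [← hfg 0 h0, hg0, Complex.exp_zero]
  have hev : deriv f =ᶠ[nhds 0] fun z => f z * deriv g z := by
    filter_upwards [Metric.isOpen_ball.mem_nhds h0] with w hw
    exact (hd w hw).deriv
  have hg' : DifferentiableAt ℂ (deriv g) 0 :=
    (hg.deriv Metric.isOpen_ball 0 h0).differentiableAt (Metric.isOpen_ball.mem_nhds h0)
  rw [hev.deriv_eq, ((hd 0 h0).fun_mul hg'.hasDerivAt).deriv, (hd 0 h0).deriv, iteratedDeriv_succ,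
    iteratedDeriv_one, hf0]
  ring

/-- The even part of a function vanishing at `0`, bounded by `C` on a disc, agrees with its
quadratic Taylor term up to a geometric tail starting at order four. -/
theorem norm_even_part_sub_le {g : ℂ → ℂ} {R C : ℝ} (hR : 0 < R)
    (hg : DifferentiableOn ℂ g (Metric.closedBall 0 R)) (hg0 : g 0 = 0)
    (hC : ∀ z ∈ Metric.closedBall (0 : ℂ) R, ‖g z‖ ≤ C) {z : ℂ} (hz : ‖z‖ < R) :
    ‖(g z + g (-z)) / 2 - z ^ 2 * iteratedDeriv 2 g 0 / 2‖
      ≤ C * ((‖z‖ / R) ^ 4 / (1 - (‖z‖ / R) ^ 2)) := by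
  set c : ℕ → ℂ := fun n => ((n.factorial : ℂ))⁻¹ * iteratedDeriv n g 0 with hc
  have hball : DifferentiableOn ℂ g (Metric.ball 0 R) := hg.mono Metric.ball_subset_closedBall
  have hcoef : ∀ n, ‖c n‖ ≤ C / R ^ n := by
    intro n
    have h1 := Complex.norm_iteratedDeriv_le_of_forall_mem_sphere_norm_le n hR
      (hg.diffContOnCl_ball subset_rfl) fun w hw => hC w (Metric.sphere_subset_closedBall hw)
    have h2 : (0 : ℝ) < n.factorial := by exact_mod_cast n.factorial_pos
    rw [hc]
    simp only
    rw [norm_mul, norm_inv, Complex.norm_natCast, inv_mul_le_iff₀ h2, ← mul_div_assoc]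
    exact h1
  have hsum : ∀ w : ℂ, ‖w‖ < R → HasSum (fun n => c n * w ^ n) (g w) := by
    intro w hw
    refine (Complex.hasSum_taylorSeries_on_ball hball (z := w) (by simpa using hw)).congr_fun ?_
    intro n
    simp only [hc, sub_zero, smul_eq_mul]
    ring
  have heven : HasSum (fun k => c (2 * k) * z ^ (2 * k)) ((g z + g (-z)) / 2) := by
    have h1 := ((hsum z hz).add (hsum (-z) (by rwa [norm_neg]))).div_const 2
    have hinj : Function.Injective fun k : ℕ => 2 * k := fun a b h => by
      simp only at h
      omega
    rw [← hinj.hasSum_iff] at h1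
    · refine h1.congr_fun fun k => ?_
      simp only [Function.comp_apply, (even_two_mul k).neg_pow]
      ring
    · intro n hn
      have hodd : Odd n := by
        rw [← Nat.not_even_iff_odd]
        rintro ⟨k, rfl⟩
        exact hn ⟨k, by simp only; omega⟩
      rw [hodd.neg_pow]
      ring
  have htail := (hasSum_nat_add_iff' 2).2 heven
  have hc0 : c 0 = 0 := by simp [hc, hg0]
  have hlead : ∑ i ∈ Finset.range 2, c (2 * i) * z ^ (2 * i) = z ^ 2 * iteratedDeriv 2 g 0 / 2 := by
    rw [Finset.sum_range_succ, Finset.sum_range_one, mul_zero, hc0]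
    simp only [hc]
    norm_num
    ring
  rw [hlead] at htail
  have hx0 : 0 ≤ ‖z‖ / R := by positivity
  have hx1 : (‖z‖ / R) ^ 2 < 1 := by
    rw [sq_lt_one_iff₀ hx0, div_lt_one hR]
    exact hz
  have hgeo := (hasSum_geometric_of_lt_one (sq_nonneg _) hx1).mul_left (C * (‖z‖ / R) ^ 4)
  rw [← mul_div_assoc, div_eq_mul_inv]
  refine htail.norm_le_of_bounded hgeo fun k => ?_
  rw [norm_mul, norm_pow]
  calc ‖c (2 * (k + 2))‖ * ‖z‖ ^ (2 * (k + 2))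
      ≤ C / R ^ (2 * (k + 2)) * ‖z‖ ^ (2 * (k + 2)) := by
        gcongr
        exact hcoef _
    _ = C * (‖z‖ / R) ^ 4 * ((‖z‖ / R) ^ 2) ^ k := by
        rw [div_mul_eq_mul_div, mul_div_assoc, ← div_pow, mul_assoc, ← pow_mul, ← pow_add]
        congr 2
        ring

end Logarithm

noncomputable section
/-! ### Amplitudes of local Hamiltonians -/

/-- The numerical condition behind the threshold time, with `ε = 1 / (D + 2)`. -/
theorem threshold_condition {D : ℕ} (hD : 1 ≤ D) :
    (Real.exp (1 / (2 * Real.exp 1 ^ 2 * (D : ℝ) * ((D : ℝ) + 1))) - 1)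
        * ((1 - 1 / ((D : ℝ) + 2))⁻¹) ^ (D + 1) * (1 + 1 / ((D : ℝ) + 2)) ^ D
      ≤ 1 / ((D : ℝ) + 2) := by
  have hD' : (1 : ℝ) ≤ D := by exact_mod_cast hD
  set e := Real.exp 1 with he
  have he2 : 2 ≤ e := by have := Real.add_one_le_exp (1 : ℝ); linarith
  have he0 : 0 < e := by linarith
  -- both powers are at most `e`
  have h1 : (1 - 1 / ((D : ℝ) + 2))⁻¹ = 1 + 1 / ((D : ℝ) + 1) := by
    have : (D : ℝ) + 2 - 1 ≠ 0 := by linarith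
    field_simp
    ring
  have h2 : (1 + 1 / ((D : ℝ) + 1)) ^ (D + 1) ≤ e := by
    calc (1 + 1 / ((D : ℝ) + 1)) ^ (D + 1) ≤ Real.exp (1 / ((D : ℝ) + 1)) ^ (D + 1) := by
          gcongr
          linarith [Real.add_one_le_exp (1 / ((D : ℝ) + 1))]
      _ = e := by
          rw [← Real.exp_nat_mul, he]
          congr 1
          push_cast
          field_simp
  have h3 : (1 + 1 / ((D : ℝ) + 2)) ^ D ≤ e := by
    calc (1 + 1 / ((D : ℝ) + 2)) ^ D ≤ Real.exp (1 / ((D : ℝ) + 2)) ^ D := by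
          gcongr
          linarith [Real.add_one_le_exp (1 / ((D : ℝ) + 2))]
      _ ≤ e := by
          rw [← Real.exp_nat_mul, he, Real.exp_le_exp, mul_one_div, div_le_one (by linarith)]
          linarith
  set t := 1 / (2 * e ^ 2 * (D : ℝ) * ((D : ℝ) + 1)) with ht
  have hden : 0 < 2 * e ^ 2 * (D : ℝ) * ((D : ℝ) + 1) := by positivity
  have ht0 : 0 < t := by positivity
  have ht1 : t ≤ 1 / 4 := by
    rw [ht]
    refine one_div_le_one_div_of_le (by norm_num) ?_
    nlinarith [mul_le_mul hD' hD' zero_le_one (by linarith : (0 : ℝ) ≤ D), sq_nonneg (e - 2)]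
  have h4 : Real.exp t - 1 ≤ 4 / 3 * t := by
    have h5 := Real.add_one_le_exp (-t)
    have h6 : Real.exp t * Real.exp (-t) = 1 := by rw [← Real.exp_add]; simp
    nlinarith [Real.exp_pos t]
  rw [h1]
  calc (Real.exp t - 1) * (1 + 1 / ((D : ℝ) + 1)) ^ (D + 1) * (1 + 1 / ((D : ℝ) + 2)) ^ D
      ≤ 4 / 3 * t * e * e := by gcongr
    _ = 2 / (3 * (D * (D + 1))) := by
        rw [ht]
        field_simp
        norm_num
    _ ≤ 1 / ((D : ℝ) + 2) := by
        rw [div_le_div_iff₀ (by positivity) (by positivity)]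
        nlinarith

namespace SpinSystem

open scoped Matrix Matrix.Norms.L2Operator

variable {V : Type*} [Fintype V] [DecidableEq V] {d : ℕ}

theorem hasDerivAt_expectation_mul_exp (A B : Operator V d) (Φ : StateVector V d) (z : ℂ) :
    HasDerivAt (fun z : ℂ => expectation (B * NormedSpace.exp (z • A)) Φ)
      (expectation (B * (A * NormedSpace.exp (z • A))) Φ) z := by
  have h := (hasDerivAt_exp_smul_const' A z).const_mul B
  exact (LinearMap.toContinuousLinearMap (expectationLM Φ)).hasFDerivAt.comp_hasDerivAt z h

theorem hasDerivAt_expectation_exp (A : Operator V d) (Φ : StateVector V d) (z : ℂ) :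
    HasDerivAt (fun z : ℂ => expectation (NormedSpace.exp (z • A)) Φ)
      (expectation (A * NormedSpace.exp (z • A)) Φ) z := by
  simpa only [one_mul] using hasDerivAt_expectation_mul_exp A 1 Φ z

/-- The second derivative at `0` of the logarithm of `z ↦ ⟨e^{zA}⟩` is the variance. -/
theorem re_second_cumulant_eq_variance (A : Operator V d) {Φ : StateVector V d}
    (hΦ : ∑ s, ‖Φ s‖ ^ 2 = 1) :
    (deriv (deriv fun z : ℂ => expectation (NormedSpace.exp (z • A)) Φ) 0
      - deriv (fun z : ℂ => expectation (NormedSpace.exp (z • A)) Φ) 0 ^ 2).re = variance A Φ := by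
  have h1 : (deriv fun z : ℂ => expectation (NormedSpace.exp (z • A)) Φ)
      = fun z => expectation (A * NormedSpace.exp (z • A)) Φ :=
    funext fun z => (hasDerivAt_expectation_exp A Φ z).deriv
  rw [h1, (hasDerivAt_expectation_mul_exp A A Φ 0).deriv, variance]
  congr 1
  simp only [zero_smul, NormedSpace.exp_zero, mul_one]
  set m := expectation A Φ with hm
  have h2 : (A - m • (1 : Operator V d)) ^ 2 = A * A - (2 * m) • A + (m ^ 2) • 1 := by
    simp only [sq, sub_mul, mul_sub, smul_mul_assoc, mul_smul_comm, one_mul, mul_one, smul_sub,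
      smul_smul, two_mul, add_smul]
    abel
  change _ = expectationLM Φ _
  rw [h2, map_add, map_sub, map_smul, map_smul]
  change _ = expectation (A * A) Φ - (2 * m) • expectation A Φ + m ^ 2 • expectation 1 Φ
  rw [expectation_one Φ hΦ, ← hm]
  simp only [smul_eq_mul]
  ring

theorem norm_expectation_exp_neg {A : Operator V d} (hA : A.IsHermitian) (Φ : StateVector V d)
    {z : ℂ} (hz : star z = -z) : ‖expectation (NormedSpace.exp ((-z) • A)) Φ‖
      = ‖expectation (NormedSpace.exp (z • A)) Φ‖ := by
  have h : (-z) • A = (z • A)ᴴ := by rw [Matrix.conjTranspose_smul, hA.eq, hz]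
  rw [h, Matrix.exp_conjTranspose, expectation_conjTranspose, norm_star]

namespace Hamiltonian

variable (H : Hamiltonian V d)

/-- The term `λ_X h_X` of a Hamiltonian. -/
def localTerm (X : H.S) : Operator V d :=
  (H.coeff X : ℂ) • H.term X

/-- The partition function `⟨Φ| exp(z ∑_{X ∈ T} λ_X h_X) |Φ⟩` of a set `T` of terms. -/
def partitionFunction (Φ : StateVector V d) (T : Finset H.S) (z : ℂ) : ℂ :=
  expectation (NormedSpace.exp (z • ∑ X ∈ T, H.localTerm X)) Φ

variable {H}

theorem norm_localTerm_le (X : H.S) : ‖H.localTerm X‖ ≤ 1 := by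
  have h1 : ‖H.term X‖ = 1 := H.norm_term X X.2
  rw [localTerm, norm_smul, h1, mul_one, Complex.norm_real]
  exact H.abs_coeff_le_one X X.2

theorem actsOn_localTerm (X : H.S) : ActsOn (H.localTerm X) X := by
  obtain ⟨a, ha⟩ := (H.term_support X X.2).1
  refine ⟨(H.coeff X : ℂ) • a, fun s s' => ?_⟩
  rw [localTerm, Matrix.smul_apply, ha, smul_ite, smul_zero]
  rfl

theorem toOperator_eq_sum_localTerm : H.toOperator = ∑ X, H.localTerm X :=
  (Finset.sum_coe_sort H.S fun X => (H.coeff X : ℂ) • H.term X).symm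

theorem isHermitian_toOperator : H.toOperator.IsHermitian := by
  rw [toOperator, Matrix.IsHermitian, Matrix.conjTranspose_sum]
  refine Finset.sum_congr rfl fun X hX => ?_
  rw [Matrix.conjTranspose_smul, (H.term_isHermitian X hX).eq]
  simp

/-- Non-interacting sets of terms have uncorrelated partition functions. -/
theorem partitionFunction_union {φ : V → Fin d → ℂ} (hφ : ∀ v, ∑ i, ‖φ v i‖ ^ 2 = 1)
    {s t : Finset H.S} (hst : Disjoint s t)
    (hadj : ∀ X ∈ s, ∀ Y ∈ t, ¬ H.interactionGraph.Adj X Y) (z : ℂ) :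
    H.partitionFunction (productState φ) (s ∪ t) z
      = H.partitionFunction (productState φ) s z * H.partitionFunction (productState φ) t z := by
  set P : Finset V := s.biUnion fun X => (X : Finset V) with hP
  have hdisj : ∀ Y ∈ t, Disjoint (Y : Finset V) P := by
    intro Y hY
    rw [hP, Finset.disjoint_biUnion_right]
    intro X hX
    by_contra hne
    rw [Finset.disjoint_iff_inter_eq_empty, ← ne_eq, ← Finset.nonempty_iff_ne_empty,
      Finset.inter_comm] at hne
    exact hadj X hX Y hY ⟨fun h => Finset.disjoint_left.1 hst hX (h ▸ hY), hne⟩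
  have hleft : ∀ X ∈ s, ∃ a, z • H.localTerm X = embedLeft P a := by
    intro X hX
    obtain ⟨a, ha⟩ := (actsOn_localTerm X).exists_embedLeft
      (Finset.subset_biUnion_of_mem (fun X : H.S => (X : Finset V)) hX)
    refine ⟨z • a, ?_⟩
    rw [ha]
    ext s s'
    exact (mul_assoc z _ _).symm
  have hright : ∀ Y ∈ t, ∃ b, z • H.localTerm Y = embedRight P b := by
    intro Y hY
    obtain ⟨b, hb⟩ := (actsOn_localTerm Y).exists_embedRight (hdisj Y hY)
    refine ⟨z • b, ?_⟩
    rw [hb]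
    ext s s'
    exact mul_left_comm z _ _
  choose! a ha using hleft
  choose! b hb using hright
  simp only [partitionFunction, Finset.smul_sum]
  rw [Finset.sum_union hst, Finset.sum_congr rfl ha, Finset.sum_congr rfl hb, ← map_sum, ← map_sum]
  exact expectation_exp_add hφ _ _

theorem norm_altSum_partitionFunction_le {Φ : StateVector V d} (hΦ : ∑ s, ‖Φ s‖ ^ 2 = 1)
    (s : Finset H.S) {z : ℂ} {r : ℝ} (hz : ‖z‖ ≤ r) :
    ‖altSum (fun T => H.partitionFunction Φ T z) s‖ ≤ (Real.exp r - 1) ^ s.card := by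
  have : Nonempty (V → Fin d) := by
    by_contra h
    rw [not_nonempty_iff] at h
    simp at hΦ
  have h1 : altSum (fun T => H.partitionFunction Φ T z) s
      = expectation (altSum (fun T => NormedSpace.exp (∑ X ∈ T, z • H.localTerm X)) s) Φ := by
    change _ = expectationLM Φ _
    unfold altSum
    rw [map_sum]
    refine Finset.sum_congr rfl fun T _ => ?_
    simp only [map_zsmul, ← Finset.smul_sum]
    rfl
  rw [h1, ← Finset.prod_const]
  refine (norm_expectation_le _ hΦ).trans
    (norm_altSum_exp_le (a := fun X => z • H.localTerm X) s fun X _ => ?_)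
  rw [norm_smul]
  exact (mul_le_of_le_one_right (norm_nonneg z) (norm_localTerm_le X)).trans hz

theorem thresholdTime_pos (hdeg : 1 ≤ H.maxDegree) : 0 < H.thresholdTime := by
  have : (0 : ℝ) < H.maxDegree := by exact_mod_cast hdeg
  unfold thresholdTime
  positivity

/-- The partition function has no zeros in the disc of radius `t_L^*`, where it has an analytic
logarithm bounded by the number of terms. -/
theorem exists_log_partitionFunction (hdeg : 1 ≤ H.maxDegree) {φ : V → Fin d → ℂ}
    (hφ : ∀ v, ∑ i, ‖φ v i‖ ^ 2 = 1) :
    ∃ g : ℂ → ℂ, DifferentiableOn ℂ g (Metric.closedBall 0 H.thresholdTime) ∧ g 0 = 0 ∧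
      ∀ z ∈ Metric.closedBall (0 : ℂ) H.thresholdTime,
        Complex.exp (g z) = expectation (NormedSpace.exp (z • H.toOperator)) (productState φ) ∧
        ‖g z‖ ≤ H.S.card := by
  classical
  have hΦ := sum_norm_sq_productState hφ
  have hD : ∀ X, (H.interactionGraph.neighborFinset X).card ≤ H.maxDegree := fun X => by
    rw [SimpleGraph.card_neighborFinset_eq_degree]
    unfold maxDegree
    convert H.interactionGraph.degree_le_maxDegree X
  have hε0 : 0 ≤ 1 / ((H.maxDegree : ℝ) + 2) := by positivity
  have hε2 : 1 / ((H.maxDegree : ℝ) + 2) ≤ 1 / 2 :=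
    one_div_le_one_div_of_le (by norm_num) (by linarith [(Nat.cast_nonneg H.maxDegree : (0:ℝ) ≤ _)])
  have hu : 0 ≤ Real.exp H.thresholdTime - 1 := by
    linarith [Real.add_one_le_exp H.thresholdTime, thresholdTime_pos hdeg]
  have key : ∀ z ∈ Metric.closedBall (0 : ℂ) H.thresholdTime, ∀ T,
      H.partitionFunction (productState φ) T z ≠ 0 ∧ ∀ X ∈ T,
      ‖H.partitionFunction (productState φ) T z
          - H.partitionFunction (productState φ) (T.erase X) z‖
        ≤ 1 / ((H.maxDegree : ℝ) + 2)
          * ‖H.partitionFunction (productState φ) (T.erase X) z‖ := by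
    intro z hz T
    refine SimpleGraph.ne_zero_and_norm_sub_erase_le
      (Z := fun T => H.partitionFunction (productState φ) T z) hD
      (fun s t hst hadj => partitionFunction_union hφ hst hadj z) ?_ hu hε0
      (hε2.trans_lt (by norm_num))
      (fun s => norm_altSum_partitionFunction_le hΦ s (by simpa using hz))
      (threshold_condition hdeg) T
    simp [partitionFunction, expectation_one _ hΦ]
  obtain ⟨g, h1, h2, h3⟩ := exists_log_of_norm_sub_erase_le
    (fun T z => (hasDerivAt_expectation_exp (∑ X ∈ T, H.localTerm X) _ z).differentiableAt)
    (fun z => by simp [expectation_one _ hΦ]) (fun T => by simp [expectation_one _ hΦ])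
    (fun z hz T => (key z hz T).1)
    (fun z hz T X hX => ((key z hz T).2 X hX).trans (by gcongr; exact le_rfl)) Finset.univ
  refine ⟨g, h1, h2, fun z hz => ?_⟩
  rw [toOperator_eq_sum_localTerm]
  simpa using h3 z hz

theorem exp_mul_exp_le_norm_amplitude (hdeg : 1 ≤ H.maxDegree) {φ : V → Fin d → ℂ}
    (hφ : ∀ v, ∑ i, ‖φ v i‖ ^ 2 = 1) {t : ℝ} (ht : |t| < H.thresholdTime) :
    Real.exp (-((H.S.card : ℝ) * ((|t| / H.thresholdTime) ^ 4 /
            (1 - (|t| / H.thresholdTime) ^ 2)))) *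
          Real.exp (-(variance H.toOperator (productState φ) * t ^ 2 / 2)) ≤
        ‖amplitude H.toOperator (productState φ) t‖ := by
  obtain ⟨g, hg, hg0, hgz⟩ := exists_log_partitionFunction hdeg hφ
  have hR := thresholdTime_pos hdeg
  set z : ℂ := -(Complex.I * t) with hz
  have hnz : ‖z‖ = |t| := by simp [hz]
  have hmem : ∀ w : ℂ, ‖w‖ = |t| → w ∈ Metric.closedBall (0 : ℂ) H.thresholdTime := fun w hw => by
    rw [mem_closedBall_zero_iff, hw]
    exact ht.le
  have hnorm : ∀ w : ℂ, ‖w‖ = |t| → Real.exp (g w).re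
      = ‖expectation (NormedSpace.exp (w • H.toOperator)) (productState φ)‖ := fun w hw => by
    rw [← (hgz w (hmem w hw)).1, Complex.norm_exp]
  -- since `H` is Hermitian, the modulus of the amplitude is even in time
  have hre : (g (-z)).re = (g z).re := by
    rw [← Real.exp_eq_exp, hnorm z hnz, hnorm (-z) (by rw [norm_neg, hnz])]
    exact norm_expectation_exp_neg isHermitian_toOperator _ (by simp [hz])
  have hcum := iteratedDeriv_two_log hR (hg.mono Metric.ball_subset_closedBall) hg0
    fun w hw => (hgz w (Metric.ball_subset_closedBall hw)).1
  have hvar := re_second_cumulant_eq_variance H.toOperator (sum_norm_sq_productState hφ)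
  rw [← hcum] at hvar
  have htail := norm_even_part_sub_le hR hg hg0 (fun w hw => (hgz w hw).2) (hnz.trans_lt ht)
  rw [hnz] at htail
  have hlow := (abs_le.1 ((Complex.abs_re_le_norm _).trans htail)).1
  have hz2 : z ^ 2 * iteratedDeriv 2 g 0 / 2 = ((-(t ^ 2 / 2) : ℝ) : ℂ) * iteratedDeriv 2 g 0 := by
    have : z ^ 2 = -(t : ℂ) ^ 2 := by
      rw [hz, neg_sq, mul_pow, Complex.I_sq]
      ring
    rw [this]
    push_cast
    ring
  have hhalf : ((g z + g (-z)) / 2).re = (g z).re := by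
    have : (g z + g (-z)) / 2 = ((1 / 2 : ℝ) : ℂ) * (g z + g (-z)) := by
      push_cast
      ring
    rw [this, Complex.re_ofReal_mul, Complex.add_re, hre]
    ring
  rw [Complex.sub_re, hhalf, hz2, Complex.re_ofReal_mul, hvar] at hlow
  rw [amplitude, ← hz, ← hnorm z hnz, ← Real.exp_add, Real.exp_le_exp]
  linarith

end Hamiltonian

end SpinSystem

theorem mainTheorem8 {V : Type*} [Fintype V] [DecidableEq V] {d : ℕ}
    (H : SpinSystem.Hamiltonian V d) (k : ℕ) (hlocal : H.IsLocal k)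
    (hdeg : 1 ≤ H.maxDegree)
    (Φ : SpinSystem.StateVector V d) (hΦ : SpinSystem.IsProductState Φ) :
    (H.thresholdTime : EReal) ≤ SpinSystem.tQSL H.toOperator Φ ∧
    ∀ t : ℝ, |t| < H.thresholdTime →
      Real.exp (-((H.S.card : ℝ) * ((|t| / H.thresholdTime) ^ 4 /
            (1 - (|t| / H.thresholdTime) ^ 2)))) *
          Real.exp (-(SpinSystem.variance H.toOperator Φ * t ^ 2 / 2)) ≤
        ‖SpinSystem.amplitude H.toOperator Φ t‖ := by
  obtain ⟨φ, hφ, hΦφ⟩ := hΦ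
  obtain rfl : Φ = SpinSystem.productState φ := funext hΦφ
  have hmain := fun t : ℝ =>
    SpinSystem.Hamiltonian.exp_mul_exp_le_norm_amplitude (t := t) hdeg hφ
  refine ⟨le_sInf ?_, hmain⟩
  rintro _ ⟨t, ⟨ht0, ht⟩, rfl⟩
  rw [EReal.coe_le_coe_iff]
  by_contra! hlt
  have h := hmain t (by rwa [abs_of_nonneg ht0])
  rw [ht, norm_zero] at h
  exact absurd h (not_le.2 (by positivity))

end
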